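/- Let $J$ be a (finite or infinite) collection of jobs such that only finitely many jobs are released up to any given time. Each job $j\in J$ has a release date $r_j\in\{0,1,2,\dots\}$, a deadline $d_j\in\{1,2,\dots\}$, a processing time $p_j\in\{1,2,\dots\}$ and a set $J_j\subseteq J$ of predecessors. Assume that $J$ is \emph{normal}: if $i\in J_j$, then $r_i=r_j$ and $d_i=d_j$. A job $j$ is \emph{available} at time $t$ if $t\ge r_j$, all jobs in $J_j$ have been completed by time $t$, and $j$ itself is not yet completed. A (preemptive, migratory) \emph{schedule} on $m$ identical processors of speed $s$ processes, at every time, at most $m$ jobs, all of them available, each on a single processor at rate $s$; job $j$ is completed once it has received $p_j$ units of work. A schedule is \emph{feasible} if every job $j$ is completed by time $d_j$, and $J$ is feasible on given processors if it has a feasible schedule on them. EDF processes, at any time, $m$ available jobs of minimum deadline (all available jobs if there are fewer than $m$), with ties broken arbitrarily. Let $m\ge 1$ be an integer. (a) If $J$ is feasible on $m$ processors of unit speed, then EDF (with any tie-breaking) meets all deadlines on $m$ processors of speed $2-1/m$. (b) For every real $\alpha\ge 1$, at least one of the following holds: 1. EDF (with any tie-breaking) completes every job of $J$ by its deadline on $m$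 processors of speed $\alpha$; 2. $J$ is infeasible even with an unlimited number of unit-speed processors; 3. there is a time interval $I=[a,b]$, $0\le a<b$, such that every feasible schedule for $J$ on unit-speed processors, however many, does more than $(\alpha m-m+1)\,|I|$ units of work within $I$, where $|I|=b-a$. -/

import Mathlib

open MeasureTheory
open scoped ENNReal

/-- A collection of precedence-constrained jobs, indexed by `J`.  The collection may be infinite, but
only finitely many jobs are released up to any given time. -/
structure JobCollection (J : Type*) where
  /-- release date `r_j` -/
  release : J → ℕ
  /-- absolute deadline `d_j` -/
  deadline : J → ℕ
  /-- processing time `p_j` -/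
  proc : J → ℕ
  /-- the set `J_j` of jobs that have to be finished before `j` becomes eligible -/
  preds : J → Set J
  deadline_pos : ∀ j, 0 < deadline j
  proc_pos : ∀ j, 0 < proc j
  finite_released : ∀ t : ℕ, {j | release j ≤ t}.Finite

namespace JobCollection

variable {J : Type*} (C : JobCollection J)

/-- Predecessors share release date and deadline. -/
def IsNormal : Prop :=
  ∀ j, ∀ i ∈ C.preds j, C.release i = C.release j ∧ C.deadline i = C.deadline j

end JobCollection

/-- A candidate schedule is given by `run : J → Set ℝ`, where `run j` is the set of times at which
job `j` occupies a processor (preemption and migration are allowed; the processors are identical, so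
only the set of running jobs matters; a job occupies at most one processor at a time).
`workDone run s j a b` is the work done on `j` during `[a, b]` by processors of speed `s`. -/
noncomputable def workDone {J : Type*} (run : J → Set ℝ) (s : ℝ) (j : J) (a b : ℝ) : ℝ≥0∞ :=
  ENNReal.ofReal s * volume (run j ∩ Set.Icc a b)

/-- The total work done during `[a, b]` on all jobs. -/
noncomputable def totalWork {J : Type*} (run : J → Set ℝ) (s : ℝ) (a b : ℝ) : ℝ≥0∞ :=
  ∑' j, workDone run s j a b

namespace JobCollection

variable {J : Type*} (C : JobCollection J)

/-- Job `j` is completed by time `t` (processors of speed `s`). -/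
def CompletedBy (run : J → Set ℝ) (s : ℝ) (j : J) (t : ℝ) : Prop :=
  (C.proc j : ℝ≥0∞) ≤ workDone run s j 0 t

/-- Job `j` is available at time `t`: it is released, all its predecessors are completed, and it is
not yet completed itself. -/
def AvailableAt (run : J → Set ℝ) (s : ℝ) (j : J) (t : ℝ) : Prop :=
  (C.release j : ℝ) ≤ t ∧ (∀ i ∈ C.preds j, C.CompletedBy run s i t) ∧ ¬ C.CompletedBy run s j t

/-- `run` is a schedule (not necessarily meeting deadlines) on `m` processors of speed `s`; `m = ⊤`
means that the number of processors is unlimited. -/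
structure IsSchedule (m : ℕ∞) (s : ℝ) (run : J → Set ℝ) : Prop where
  measurable : ∀ j, MeasurableSet (run j)
  available : ∀ j, ∀ t ∈ run j, C.AvailableAt run s j t
  card_le : ∀ t : ℝ, {j | t ∈ run j}.encard ≤ m

/-- All jobs are completed within their deadlines. -/
def MeetsDeadlines (s : ℝ) (run : J → Set ℝ) : Prop :=
  ∀ j, C.CompletedBy run s j (C.deadline j)

/-- A feasible schedule on `m` processors of speed `s`. -/
def IsFeasibleSchedule (m : ℕ∞) (s : ℝ) (run : J → Set ℝ) : Prop :=
  C.IsSchedule m s run ∧ C.MeetsDeadlines s run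

/-- The collection is feasible on `m` processors of speed `s`. -/
def FeasibleOn (m : ℕ∞) (s : ℝ) : Prop :=
  ∃ run : J → Set ℝ, C.IsFeasibleSchedule m s run

/-- `run` is an EDF schedule on `m` processors of speed `s`, for some way of breaking ties: at any
time the running jobs are `m` available jobs of minimum deadline (all available jobs, if there are
fewer than `m`).  That is, an available job is left waiting only if `m` jobs are running, none of
which has a later deadline. -/
structure IsEDF (m : ℕ) (s : ℝ) (run : J → Set ℝ) : Prop extends C.IsSchedule m s run where
  edf : ∀ j, ∀ t : ℝ, C.AvailableAt run s j t → t ∉ run j →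
    {k | t ∈ run k}.encard = m ∧ ∀ k, t ∈ run k → C.deadline k ≤ C.deadline j

/-- EDF meets all deadlines on `m` processors of speed `s`, however ties are broken. -/
def EDFSchedulable (m : ℕ) (s : ℝ) : Prop :=
  ∀ run : J → Set ℝ, C.IsEDF m s run → C.MeetsDeadlines s run

end JobCollection

/-!
# EDF with speed augmentation for normal precedence-constrained jobs

Suppose that EDF at speed `α` on `m` processors misses the deadline `d` of a job, although the
collection has a feasible unit-speed schedule on unlimited processors.  Only the finite set `F` of
jobs with deadline at most `d` matters, because jobs with later deadlines never displace these.  Call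
a time *slack* if fewer than `m` jobs of `F` are running; at a slack time every available job of `F`
is running.

The heart of the proof is a time change (`JobCollection.IsEDF.work_le`).  Let `y t` be `α` times the
amount of slack in `[r, t]`.  For every job `k ∈ F` with release date `r`, EDF has by time `t` done at
least as much work on `k` as any feasible unit-speed schedule has by time `r + y t`.  This is proved
by induction along the precedence relation, which stays inside the jobs of release date `r` by
normality: once the predecessors of `k` are finished, `k` progresses at speed `α` in all slack times.
Hence, if EDF is behind some feasible schedule on `k` at time `τ`, then `α` times the slack in
`[r, τ]` is less than `τ - r`, and some job of `F` is running throughout `[r, τ]`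
(`JobCollection.IsEDF.isTight_of_behind`).

Let `r` be the least natural number for which `[r, d]` has these two properties; the release date of
the late job is one such number.  At time `r`, EDF is not behind any feasible schedule on any job of
`F`, since otherwise the release date of that job would be a smaller choice.  All jobs of `F` have to
be completed by `d`, so every feasible schedule does in `[r, d]` more work than EDF does there on
`F`; and the bound on the slack shows that EDF does at least `(α m - m + 1) (d - r)`.

With `α = 2 - 1 / m` this quantity is `m (d - r)`, and `m` unit-speed processors cannot do more work
than that in `[r, d]`, which gives the statement about schedules on `m` processors.
-/

/-! ### The length of a set of times within an interval -/

/-- The length of the part of `A` that lies within `[a, b]`. -/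
noncomputable def timeIn (A : Set ℝ) (a b : ℝ) : ℝ := volume.real (A ∩ Set.Icc a b)

lemma volume_inter_Icc_ne_top (A : Set ℝ) (a b : ℝ) : volume (A ∩ Set.Icc a b) ≠ ⊤ :=
  measure_ne_top_of_subset Set.inter_subset_right measure_Icc_lt_top.ne

lemma timeIn_nonneg (A : Set ℝ) (a b : ℝ) : 0 ≤ timeIn A a b := measureReal_nonneg

lemma timeIn_mono_of_subset {A B : Set ℝ} {a b a' b' : ℝ}
    (h : A ∩ Set.Icc a b ⊆ B ∩ Set.Icc a' b') : timeIn A a b ≤ timeIn B a' b' :=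
  measureReal_mono h (volume_inter_Icc_ne_top _ _ _)

lemma timeIn_mono_right (A : Set ℝ) (a : ℝ) {b c : ℝ} (h : b ≤ c) : timeIn A a b ≤ timeIn A a c :=
  timeIn_mono_of_subset (Set.inter_subset_inter_right _ (Set.Icc_subset_Icc_right h))

lemma timeIn_le (A : Set ℝ) {a b : ℝ} (h : a ≤ b) : timeIn A a b ≤ b - a := by
  have := measureReal_mono (μ := volume) (Set.inter_subset_right : A ∩ Set.Icc a b ⊆ Set.Icc a b)
    measure_Icc_lt_top.ne
  rwa [Real.volume_real_Icc_of_le h] at this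

lemma timeIn_add {A : Set ℝ} (hA : MeasurableSet A) {a b c : ℝ} (hab : a ≤ b) (hbc : b ≤ c) :
    timeIn A a c = timeIn A a b + timeIn A b c := by
  have hsplit : A ∩ Set.Icc a c = A ∩ Set.Icc a b ∪ A ∩ Set.Icc b c := by
    rw [← Set.inter_union_distrib_left, Set.Icc_union_Icc_eq_Icc hab hbc]
  unfold timeIn
  rw [hsplit, measureReal_def, measure_union₀ (hA.inter measurableSet_Icc).nullMeasurableSet,
    ENNReal.toReal_add (volume_inter_Icc_ne_top _ _ _) (volume_inter_Icc_ne_top _ _ _)]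
  · rfl
  · refine measure_mono_null (t := {b}) ?_ (by simp)
    rintro t ⟨⟨-, h1⟩, -, h2⟩
    exact le_antisymm h1.2 h2.1

lemma timeIn_eq_zero {A : Set ℝ} {a b : ℝ} (h : ∀ t ∈ A, b ≤ t) : timeIn A a b = 0 := by
  unfold timeIn
  rw [measureReal_def, measure_mono_null (t := {b}) ?_ (by simp), ENNReal.toReal_zero]
  rintro t ⟨h1, h2⟩
  exact le_antisymm h2.2 (h t h1)

lemma timeIn_le_sub_of_lower_bound {A : Set ℝ} {a b s : ℝ} (h : ∀ t ∈ A, s ≤ t) (hs : s ≤ b) :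
    timeIn A a b ≤ b - s :=
  (timeIn_mono_of_subset fun t ht => ⟨ht.1, h t ht.1, ht.2.2⟩).trans (timeIn_le A hs)

lemma continuousOn_timeIn {A : Set ℝ} (hA : MeasurableSet A) (a : ℝ) :
    ContinuousOn (timeIn A a) (Set.Ici a) := by
  have key : ∀ x ∈ Set.Ici a, ∀ y ∈ Set.Ici a, timeIn A a x ≤ timeIn A a y + dist x y := by
    intro x hx y hy
    rcases le_total x y with h | h
    · linarith [timeIn_mono_right A a h, dist_nonneg (x := x) (y := y)]
    · rw [timeIn_add hA hy h, Real.dist_eq, abs_of_nonneg (sub_nonneg.2 h)]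
      linarith [timeIn_le A h]
  exact (LipschitzOnWith.of_le_add key).continuousOn

lemma sum_timeIn_eq_integral {J : Type*} {run : J → Set ℝ} (hrun : ∀ j, MeasurableSet (run j))
    (F : Finset J) (a b : ℝ) :
    ∑ k ∈ F, timeIn (run k) a b =
      ∫ t in Set.Icc a b, ∑ k ∈ F, (run k).indicator (fun _ => (1 : ℝ)) t := by
  rw [integral_finsetSum]
  · refine Finset.sum_congr rfl fun k _ => ?_
    rw [integral_indicator_const _ (hrun k), measureReal_restrict_apply (hrun k)]
    simp [timeIn]
  · intro k _
    exact (integrable_const (1 : ℝ)).indicator (hrun k)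

/-- The number of jobs of `F` that are running at time `t`, as a real number. -/
noncomputable def load {J : Type*} (run : J → Set ℝ) (F : Finset J) (t : ℝ) : ℝ :=
  ∑ k ∈ F, (run k).indicator (fun _ => (1 : ℝ)) t

/-- The times at which fewer than `m` jobs of `F` are running. -/
def slack {J : Type*} (run : J → Set ℝ) (F : Finset J) (m : ℕ) : Set ℝ := {t | load run F t < m}

section Load

variable {J : Type*} {run : J → Set ℝ}

lemma measurable_load (hrun : ∀ j, MeasurableSet (run j)) (F : Finset J) :
    Measurable (load run F) :=
  Finset.measurable_fun_sum _ fun k _ => measurable_const.indicator (hrun k)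

lemma measurableSet_slack (hrun : ∀ j, MeasurableSet (run j)) (F : Finset J) (m : ℕ) :
    MeasurableSet (slack run F m) :=
  measurableSet_lt (measurable_load hrun F) measurable_const

open Classical in
lemma load_eq_card (F : Finset J) (t : ℝ) : load run F t = (F.filter (t ∈ run ·)).card := by
  simp [load, Set.indicator_apply, Finset.sum_boole]

lemma load_le {F : Finset J} {t : ℝ} {m : ℕ} (h : {j | t ∈ run j}.encard ≤ m) :
    load run F t ≤ m := by
  classical
  rw [load_eq_card]
  have h1 : ((F.filter (t ∈ run ·) : Finset J) : Set J).encard ≤ m :=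
    (Set.encard_le_encard fun k hk => by simp at hk; exact hk.2).trans h
  rw [Set.encard_coe_eq_coe_finsetCard] at h1
  exact_mod_cast h1

lemma load_eq_of_subset {F : Finset J} {t : ℝ} {m : ℕ} (h : {j | t ∈ run j}.encard = m)
    (hF : ∀ j, t ∈ run j → j ∈ F) : load run F t = m := by
  classical
  rw [load_eq_card]
  have h1 : ((F.filter (t ∈ run ·) : Finset J) : Set J) = {j | t ∈ run j} := by
    ext k
    simpa using hF k
  rw [← h1, Set.encard_coe_eq_coe_finsetCard] at h
  exact_mod_cast h

lemma one_le_load {F : Finset J} {t : ℝ} {k : J} (hk : k ∈ F) (ht : t ∈ run k) :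
    1 ≤ load run F t := by
  classical
  rw [load_eq_card]
  exact_mod_cast Finset.card_pos.2 ⟨k, by simp [hk, ht]⟩

lemma integrableOn_load (hrun : ∀ j, MeasurableSet (run j)) (F : Finset J) (a b : ℝ) :
    IntegrableOn (load run F) (Set.Icc a b) :=
  integrable_finsetSum _ fun k _ => (integrable_const (1 : ℝ)).indicator (hrun k)

lemma sum_timeIn_le (hrun : ∀ j, MeasurableSet (run j)) {m : ℕ}
    (hm : ∀ t : ℝ, {j | t ∈ run j}.encard ≤ m) (F : Finset J) {a b : ℝ} (hab : a ≤ b) :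
    ∑ k ∈ F, timeIn (run k) a b ≤ m * (b - a) := by
  rw [sum_timeIn_eq_integral hrun]
  calc ∫ t in Set.Icc a b, load run F t ≤ ∫ _ in Set.Icc a b, (m : ℝ) :=
        integral_mono (integrableOn_load hrun F a b) (integrable_const _)
          fun t => load_le (hm t)
    _ = m * (b - a) := by
        rw [setIntegral_const, Real.volume_real_Icc_of_le hab, smul_eq_mul, mul_comm]

/-- If some job of `F` is running throughout `[a, b]`, the load is at least `1` in slack times and
`m` otherwise. -/
lemma le_sum_timeIn (hrun : ∀ j, MeasurableSet (run j)) (m : ℕ) (F : Finset J) {a b : ℝ}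
    (hab : a ≤ b) (hF : ∀ t ∈ Set.Icc a b, ∃ k ∈ F, t ∈ run k) :
    m * (b - a) - (m - 1) * timeIn (slack run F m) a b ≤ ∑ k ∈ F, timeIn (run k) a b := by
  have hmeas := measurableSet_slack hrun F m
  have hind : Integrable ((slack run F m).indicator fun _ => (m - 1 : ℝ))
      (volume.restrict (Set.Icc a b)) := (integrable_const _).indicator hmeas
  rw [sum_timeIn_eq_integral hrun]
  calc (m : ℝ) * (b - a) - (m - 1) * timeIn (slack run F m) a b
      = ∫ t in Set.Icc a b, ((m : ℝ) - (slack run F m).indicator (fun _ => (m - 1 : ℝ)) t) := by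
        rw [integral_sub (integrable_const _) hind, setIntegral_const,
          Real.volume_real_Icc_of_le hab, integral_indicator_const _ hmeas,
          measureReal_restrict_apply hmeas, timeIn, smul_eq_mul, smul_eq_mul]
        ring
    _ ≤ ∫ t in Set.Icc a b, load run F t := by
        refine setIntegral_mono_on ((integrable_const _).sub hind) (integrableOn_load hrun F a b)
          measurableSet_Icc fun t ht => ?_
        by_cases h : t ∈ slack run F m
        · obtain ⟨k, hk, hkt⟩ := hF t ht
          simpa [h] using one_le_load hk hkt
        · rw [Set.indicator_of_notMem h, sub_zero]
          exact not_lt.1 h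

end Load

/-! ### Schedules -/

lemma workDone_eq_ofReal {J : Type*} (run : J → Set ℝ) {s : ℝ} (hs : 0 ≤ s) (j : J) (a b : ℝ) :
    workDone run s j a b = ENNReal.ofReal (s * timeIn (run j) a b) := by
  rw [workDone, ENNReal.ofReal_mul hs, timeIn, ofReal_measureReal (volume_inter_Icc_ne_top _ _ _)]

lemma ofReal_sum_le_totalWork {J : Type*} (run : J → Set ℝ) (F : Finset J) (a b : ℝ) :
    ENNReal.ofReal (∑ k ∈ F, timeIn (run k) a b) ≤ totalWork run 1 a b := by
  rw [ENNReal.ofReal_sum_of_nonneg fun k _ => timeIn_nonneg _ _ _]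
  refine le_trans (le_of_eq ?_) (ENNReal.sum_le_tsum F)
  exact Finset.sum_congr rfl fun k _ => by rw [workDone_eq_ofReal _ zero_le_one, one_mul]

namespace JobCollection

variable {J : Type*} {C : JobCollection J}

lemma completedBy_iff {run : J → Set ℝ} {s : ℝ} (hs : 0 ≤ s) {j : J} {t : ℝ} :
    C.CompletedBy run s j t ↔ (C.proc j : ℝ) ≤ s * timeIn (run j) 0 t := by
  rw [CompletedBy, workDone_eq_ofReal _ hs, ← ENNReal.ofReal_natCast,
    ENNReal.ofReal_le_ofReal_iff (mul_nonneg hs (timeIn_nonneg _ _ _))]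

lemma CompletedBy.mono {run : J → Set ℝ} {s : ℝ} {j : J} {t u : ℝ} (h : C.CompletedBy run s j t)
    (htu : t ≤ u) : C.CompletedBy run s j u := by
  refine le_trans h ?_
  unfold workDone
  gcongr

lemma one_le_proc (C : JobCollection J) (j : J) : (1 : ℝ) ≤ C.proc j := by
  exact_mod_cast C.proc_pos j

/-- A job never receives more work than its processing time, since it stops being available when it
is completed. -/
lemma IsSchedule.work_le_proc {m : ℕ∞} {s : ℝ} {run : J → Set ℝ} (h : C.IsSchedule m s run)
    (hs : 0 ≤ s) (j : J) (t : ℝ) : s * timeIn (run j) 0 t ≤ C.proc j := by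
  by_contra! hlt
  have ht : 0 ≤ t := by
    by_contra! ht
    have : timeIn (run j) 0 t = 0 := by simp [timeIn, Set.Icc_eq_empty_of_lt ht]
    rw [this, mul_zero] at hlt
    linarith [C.one_le_proc j]
  have hcont : ContinuousOn (fun u => s * timeIn (run j) 0 u) (Set.Icc 0 t) :=
    continuousOn_const.mul ((continuousOn_timeIn (h.measurable j) 0).mono Set.Icc_subset_Ici_self)
  have h0 : s * timeIn (run j) 0 0 = 0 := by
    rw [timeIn_eq_zero fun u hu => (Nat.cast_nonneg _).trans (h.available j u hu).1, mul_zero]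
  obtain ⟨u, hu, hu'⟩ := intermediate_value_Icc ht hcont
    (show (C.proc j : ℝ) ∈ Set.Icc _ _ from
      ⟨by rw [h0]; exact Nat.cast_nonneg _, hlt.le⟩)
  have hz : timeIn (run j) u t = 0 := by
    have : run j ∩ Set.Icc u t = ∅ := by
      ext v
      simp only [Set.mem_inter_iff, Set.mem_empty_iff_false, iff_false]
      rintro ⟨hv, hv'⟩
      exact (h.available j v hv).2.2 (((completedBy_iff hs).2 hu'.ge).mono hv'.1)
    simp [timeIn, this]
  rw [timeIn_add (h.measurable j) hu.1 hu.2, hz, add_zero] at hlt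
  exact absurd hu' hlt.ne'

lemma totalWork_le {m : ℕ} {run : J → Set ℝ} (h : C.IsSchedule m 1 run) {a b : ℝ} (hab : a ≤ b) :
    totalWork run 1 a b ≤ ENNReal.ofReal (m * (b - a)) := by
  refine ENNReal.summable.tsum_le_of_sum_le fun F => ?_
  simp_rw [workDone_eq_ofReal _ zero_le_one, one_mul]
  rw [← ENNReal.ofReal_sum_of_nonneg fun k _ => timeIn_nonneg _ _ _]
  exact ENNReal.ofReal_le_ofReal (sum_timeIn_le h.measurable h.card_le F hab)

lemma IsFeasibleSchedule.of_le {m n : ℕ∞} (hmn : m ≤ n) {s : ℝ} {run : J → Set ℝ}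
    (h : C.IsFeasibleSchedule m s run) : C.IsFeasibleSchedule n s run :=
  ⟨⟨h.1.measurable, h.1.available, fun t => (h.1.card_le t).trans hmn⟩, h.2⟩

/-! ### Feasible unit-speed schedules -/

section Feasible

variable {n : ℕ∞} {S : J → Set ℝ}

lemma IsSchedule.release_lt_of_work_pos {s : ℝ} (h : C.IsSchedule n s S) {j : J} {t : ℝ}
    (ht : 0 < timeIn (S j) 0 t) : (C.release j : ℝ) < t := by
  by_contra! hle
  exact ht.ne' (timeIn_eq_zero fun u hu => hle.trans (h.available j u hu).1)

lemma IsFeasibleSchedule.proc_le (h : C.IsFeasibleSchedule n 1 S) (j : J) :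
    (C.proc j : ℝ) ≤ timeIn (S j) 0 (C.deadline j) := by
  simpa using (completedBy_iff zero_le_one).1 (h.2 j)

lemma IsFeasibleSchedule.release_lt_deadline (h : C.IsFeasibleSchedule n 1 S) (j : J) :
    C.release j < C.deadline j := by
  exact_mod_cast h.1.release_lt_of_work_pos
    (lt_of_lt_of_le (by linarith [C.one_le_proc j]) (h.proc_le j))

lemma IsFeasibleSchedule.finite_deadline_le (h : C.IsFeasibleSchedule n 1 S) (d : ℕ) :
    {j | C.deadline j ≤ d}.Finite :=
  (C.finite_released d).subset fun j hj => (h.release_lt_deadline j).le.trans hj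

lemma IsFeasibleSchedule.run_nonempty (h : C.IsFeasibleSchedule n 1 S) (j : J) :
    (S j).Nonempty := by
  by_contra! he
  have := h.proc_le j
  simp [he, timeIn] at this
  exact (C.proc_pos j).ne' this

lemma IsSchedule.release_le_sInf (h : C.IsSchedule n 1 S) {j : J} (hj : (S j).Nonempty) :
    (C.release j : ℝ) ≤ sInf (S j) :=
  le_csInf hj fun u hu => (h.available j u hu).1

lemma IsSchedule.sInf_le (h : C.IsSchedule n 1 S) {j : J} : ∀ t ∈ S j, sInf (S j) ≤ t :=
  fun _ ht => csInf_le ⟨C.release j, fun u hu => (h.available j u hu).1⟩ ht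

/-- By continuity, the predecessors of a job are completed already at the infimum of the times at
which it runs. -/
lemma IsFeasibleSchedule.proc_pred_le (h : C.IsFeasibleSchedule n 1 S) {i j : J}
    (hi : i ∈ C.preds j) : (C.proc i : ℝ) ≤ timeIn (S i) 0 (sInf (S j)) := by
  have hcl : IsClosed {u ∈ Set.Ici (0 : ℝ) | (C.proc i : ℝ) ≤ timeIn (S i) 0 u} :=
    isClosed_Ici.isClosed_le continuousOn_const (continuousOn_timeIn (h.1.measurable i) 0)
  refine (closure_minimal (fun u hu => ?_) hcl (csInf_mem_closure (h.run_nonempty j)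
    ⟨C.release j, fun u hu => (h.1.available j u hu).1⟩)).2
  obtain ⟨h1, h2, -⟩ := h.1.available j u hu
  exact ⟨(Nat.cast_nonneg _).trans h1, by simpa using (completedBy_iff zero_le_one).1 (h2 i hi)⟩

/-- A feasible schedule rules out cyclic precedence constraints: a job starts at least one time unit
later than each of its predecessors. -/
lemma IsFeasibleSchedule.wellFounded_preds (h : C.IsFeasibleSchedule n 1 S) :
    WellFounded fun i j => i ∈ C.preds j := by
  refine Subrelation.wf ?_ (measure fun j => ⌊sInf (S j)⌋₊).wf
  intro i j hi
  have hp := h.proc_pred_le hi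
  have h0 : 0 ≤ sInf (S i) := (Nat.cast_nonneg _).trans (h.1.release_le_sInf (h.run_nonempty i))
  have hle : sInf (S i) ≤ sInf (S j) := by
    by_contra! hlt
    rw [timeIn_eq_zero fun u hu => hlt.le.trans (h.1.sInf_le u hu)] at hp
    linarith [C.one_le_proc i]
  have h1 : sInf (S i) + 1 ≤ sInf (S j) := by
    have := timeIn_le_sub_of_lower_bound (a := 0) h.1.sInf_le hle
    linarith [C.one_le_proc i]
  change ⌊sInf (S i)⌋₊ < ⌊sInf (S j)⌋₊
  have := Nat.floor_le_floor h1
  rw [Nat.floor_add_one h0] at this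
  omega

end Feasible

/-! ### Comparing EDF with feasible schedules -/

section EDF

variable {m : ℕ} {α : ℝ} {run S : J → Set ℝ} {d : ℕ} {F : Finset J}

/-- Jobs with deadline at most `d` are displaced only by `m` such jobs. -/
lemma IsEDF.mem_run_of_slack (h : C.IsEDF m α run) (hF : ∀ j, j ∈ F ↔ C.deadline j ≤ d) {k : J}
    (hk : k ∈ F) {t : ℝ} (hav : C.AvailableAt run α k t) (ht : t ∈ slack run F m) :
    t ∈ run k := by
  by_contra hn
  obtain ⟨h1, h2⟩ := h.edf k t hav hn
  exact (ne_of_lt ht) (load_eq_of_subset h1 fun i hi => (hF i).2 ((h2 i hi).trans ((hF k).1 hk)))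

/-- While some job of `F` is released and unfinished, a job of `F` is running: going back along
unfinished predecessors, one arrives at an available job. -/
lemma IsEDF.exists_running (h : C.IsEDF m α run) (hm : 1 ≤ m) (hC : C.IsNormal)
    (hS : C.IsFeasibleSchedule ⊤ 1 S) (hF : ∀ j, j ∈ F ↔ C.deadline j ≤ d) {t : ℝ} (k : J)
    (hk : k ∈ F) (hr : (C.release k : ℝ) ≤ t) (hc : ¬ C.CompletedBy run α k t) :
    ∃ i ∈ F, t ∈ run i := by
  induction k using hS.wellFounded_preds.induction with
  | _ k ih =>
    by_cases hp : ∀ i ∈ C.preds k, C.CompletedBy run α i t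
    · by_cases hrun : t ∈ run k
      · exact ⟨k, hk, hrun⟩
      · obtain ⟨h1, h2⟩ := h.edf k t ⟨hr, hp, hc⟩ hrun
        have hne : {i | t ∈ run i}.Nonempty := by
          rw [← Set.encard_pos, h1]
          exact_mod_cast hm
        obtain ⟨i, hi⟩ := hne
        exact ⟨i, (hF i).2 ((h2 i hi).trans ((hF k).1 hk)), hi⟩
    · push Not at hp
      obtain ⟨i, hi, hic⟩ := hp
      obtain ⟨h1, h2⟩ := hC k i hi
      exact ih i hi ((hF i).2 (h2.trans_le ((hF k).1 hk))) (by rwa [h1]) hic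

/-- EDF at time `t` is not behind a feasible unit-speed schedule at the time that exceeds the release
date by `α` times the slack so far. -/
lemma IsEDF.work_le (h : C.IsEDF m α run) (hα : 0 ≤ α) (hC : C.IsNormal)
    (hS : C.IsFeasibleSchedule ⊤ 1 S) (hF : ∀ j, j ∈ F ↔ C.deadline j ≤ d) (k : J)
    (hk : k ∈ F) {t : ℝ} (ht : (C.release k : ℝ) ≤ t) :
    timeIn (S k) 0 (C.release k + α * timeIn (slack run F m) (C.release k) t) ≤
      α * timeIn (run k) 0 t := by
  induction k using hS.wellFounded_preds.induction generalizing t with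
  | _ k ih =>
    set r : ℝ := (C.release k : ℝ)
    have hr0 : 0 ≤ r := Nat.cast_nonneg _
    set L := slack run F m
    have hLm : MeasurableSet L := measurableSet_slack h.measurable F m
    set s := sInf (S k)
    have hrs : r ≤ s := hS.1.release_le_sInf (hS.run_nonempty k)
    rcases lt_or_ge (r + α * timeIn L r t) s with hlt | hge
    · rw [timeIn_eq_zero fun u hu => hlt.le.trans (hS.1.sInf_le u hu)]
      exact mul_nonneg hα (timeIn_nonneg _ _ _)
    · -- `u` is the time that the time change maps to the start `s` of `k` in `S`.
      have hcont : ContinuousOn (fun v => r + α * timeIn L r v) (Set.Icc r t) :=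
        continuousOn_const.add (continuousOn_const.mul
          ((continuousOn_timeIn hLm r).mono Set.Icc_subset_Ici_self))
      have hstart : r + α * timeIn L r r ≤ s := by
        have : timeIn L r r = 0 := le_antisymm (by simpa using timeIn_le L le_rfl)
          (timeIn_nonneg _ _ _)
        simpa [this] using hrs
      obtain ⟨u, hu, hus⟩ := intermediate_value_Icc ht hcont ⟨hstart, hge⟩
      have hpred : ∀ i ∈ C.preds k, C.CompletedBy run α i u := by
        intro i hi
        obtain ⟨h1, h2⟩ := hC k i hi
        have := ih i hi ((hF i).2 (h2.trans_le ((hF k).1 hk))) (t := u) (by rw [h1]; exact hu.1)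
        rw [h1] at this
        rw [completedBy_iff hα]
        refine le_trans (hS.proc_pred_le hi) (le_trans (le_of_eq ?_) this)
        exact congrArg _ hus.symm
      by_cases hc : C.CompletedBy run α k t
      · have := hS.1.work_le_proc zero_le_one k (r + α * timeIn L r t)
        rw [one_mul] at this
        exact this.trans ((completedBy_iff hα).1 hc)
      · have hsub : timeIn L u t ≤ timeIn (run k) 0 t := by
          refine timeIn_mono_of_subset fun v hv => ⟨?_, hr0.trans (hu.1.trans hv.2.1), hv.2.2⟩
          exact h.mem_run_of_slack hF hk ⟨hu.1.trans hv.2.1,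
            fun i hi => (hpred i hi).mono hv.2.1, fun hcv => hc (hcv.mono hv.2.2)⟩ hv.1
        have hadd := timeIn_add hLm hu.1 hu.2
        have hle := timeIn_le_sub_of_lower_bound (a := 0) hS.1.sInf_le hge
        calc timeIn (S k) 0 (r + α * timeIn L r t) ≤ r + α * timeIn L r t - s := hle
          _ = α * timeIn L u t := by
              rw [← hus, hadd]
              ring
          _ ≤ α * timeIn (run k) 0 t := mul_le_mul_of_nonneg_left hsub hα

end EDF

/-- An interval `[a, b]` with little slack in which some job of `F` is always running.  Adjacent
tight intervals combine to a tight interval. -/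
structure IsTight (m : ℕ) (α : ℝ) (run : J → Set ℝ) (F : Finset J) (a b : ℝ) : Prop where
  lt : a < b
  slack_lt : α * timeIn (slack run F m) a b < b - a
  running : ∀ t ∈ Set.Icc a b, ∃ k ∈ F, t ∈ run k

section Tight

variable {m : ℕ} {α : ℝ} {run S : J → Set ℝ} {d : ℕ} {F : Finset J}

lemma IsTight.trans (hrun : ∀ j, MeasurableSet (run j)) {a b c : ℝ}
    (h₁ : IsTight m α run F a b) (h₂ : IsTight m α run F b c) : IsTight m α run F a c where
  lt := h₁.lt.trans h₂.lt
  slack_lt := by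
    rw [timeIn_add (measurableSet_slack hrun F m) h₁.lt.le h₂.lt.le]
    linarith [h₁.slack_lt, h₂.slack_lt]
  running t ht := (le_total t b).elim (fun h => h₁.running t ⟨ht.1, h⟩)
    fun h => h₂.running t ⟨h, ht.2⟩

/-- If EDF is behind a feasible schedule on a job at time `τ`, then the time from the release of that
job to `τ` is tight. -/
lemma IsEDF.isTight_of_behind (h : C.IsEDF m α run) (hm : 1 ≤ m) (hα : 0 ≤ α) (hC : C.IsNormal)
    (hS : C.IsFeasibleSchedule ⊤ 1 S) (hF : ∀ j, j ∈ F ↔ C.deadline j ≤ d) {k : J} (hk : k ∈ F)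
    {τ : ℝ} (hlt : α * timeIn (run k) 0 τ < timeIn (S k) 0 τ) :
    IsTight m α run F (C.release k) τ := by
  have hr : (C.release k : ℝ) < τ := hS.1.release_lt_of_work_pos
    (lt_of_le_of_lt (mul_nonneg hα (timeIn_nonneg _ _ _)) hlt)
  refine ⟨hr, ?_, fun t ht => ?_⟩
  · by_contra! hge
    have h1 := h.work_le hα hC hS hF k hk hr.le
    have h2 := timeIn_mono_right (S k) 0 (b := τ)
      (c := C.release k + α * timeIn (slack run F m) (C.release k) τ) (by linarith)
    linarith
  · refine h.exists_running hm hC hS hF k hk ht.1 fun hc => ?_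
    have h1 := (completedBy_iff hα).1 (hc.mono ht.2)
    have h2 := hS.1.work_le_proc zero_le_one k τ
    linarith

end Tight

/-- If EDF at speed `α` misses a deadline of a feasible collection, there is an interval in which
every feasible unit-speed schedule has to do much work. -/
theorem IsEDF.exists_busy_interval {C : JobCollection J} (hC : C.IsNormal) {m : ℕ} (hm : 1 ≤ m)
    {α : ℝ} (hα : 1 ≤ α) {run : J → Set ℝ} (h : C.IsEDF m α run) (hmiss : ¬ C.MeetsDeadlines α run)
    (hfeas : C.FeasibleOn ⊤ 1) :
    ∃ a b : ℝ, 0 ≤ a ∧ a < b ∧ ∀ S : J → Set ℝ, C.IsFeasibleSchedule ⊤ 1 S →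
      ENNReal.ofReal ((α * m - m + 1) * (b - a)) < totalWork S 1 a b := by
  classical
  have hα₀ : 0 ≤ α := zero_le_one.trans hα
  obtain ⟨S₀, hS₀⟩ := hfeas
  unfold MeetsDeadlines at hmiss
  push Not at hmiss
  obtain ⟨j, hj⟩ := hmiss
  rw [completedBy_iff hα₀, not_le] at hj
  set d := C.deadline j
  set F := (hS₀.finite_deadline_le d).toFinset
  have hF : ∀ k, k ∈ F ↔ C.deadline k ≤ d := fun k => by simp [F]
  have hjF : j ∈ F := (hF j).2 le_rfl
  have hex : ∃ r : ℕ, IsTight m α run F r d :=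
    ⟨C.release j, h.isTight_of_behind hm hα₀ hC hS₀ hF hjF (hj.trans_le (hS₀.proc_le j))⟩
  obtain ⟨r, hr, hmin⟩ : ∃ r : ℕ, IsTight m α run F r d ∧ ∀ r' < r, ¬ IsTight m α run F r' d :=
    ⟨Nat.find hex, Nat.find_spec hex, fun _ => Nat.find_min hex⟩
  refine ⟨r, d, Nat.cast_nonneg _, hr.lt, fun S hS => ?_⟩
  have hr0 : (0 : ℝ) ≤ r := Nat.cast_nonneg _
  -- Otherwise the release date of `k` would start a longer tight interval, against the choice of `r`.
  have hahead : ∀ k ∈ F, timeIn (S k) 0 r ≤ α * timeIn (run k) 0 r := by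
    intro k hk
    by_contra! hlt
    have ht := h.isTight_of_behind hm hα₀ hC hS hF hk hlt
    exact hmin _ (by exact_mod_cast ht.lt) (ht.trans h.measurable hr)
  have hdone : ∀ k ∈ F, (C.proc k : ℝ) ≤ timeIn (S k) 0 d := fun k hk =>
    (hS.proc_le k).trans (timeIn_mono_right _ _ (by exact_mod_cast (hF k).1 hk))
  -- What EDF has left undone on `F` at time `d` makes the inequality strict: job `j` is late.
  have hsum : α * ∑ k ∈ F, timeIn (run k) r d < ∑ k ∈ F, timeIn (S k) r d := by
    rw [Finset.mul_sum]
    refine Finset.sum_lt_sum (fun k hk => ?_) ⟨j, hjF, ?_⟩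
    · have h1 := h.work_le_proc hα₀ k d
      rw [timeIn_add (h.measurable k) hr0 hr.lt.le] at h1
      have h2 := hdone k hk
      rw [timeIn_add (hS.1.measurable k) hr0 hr.lt.le] at h2
      linarith [hahead k hk]
    · rw [timeIn_add (h.measurable j) hr0 hr.lt.le] at hj
      have h2 := hdone j hjF
      rw [timeIn_add (hS.1.measurable j) hr0 hr.lt.le] at h2
      linarith [hahead j hjF]
  have hlow := mul_le_mul_of_nonneg_left (le_sum_timeIn h.measurable m F hr.lt.le hr.running) hα₀
  have hm1 : (0 : ℝ) ≤ m - 1 := by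
    have : (1 : ℝ) ≤ m := by exact_mod_cast hm
    linarith
  have hslack := mul_le_mul_of_nonneg_left hr.slack_lt.le hm1
  have hfin : (α * m - m + 1) * ((d : ℝ) - r) < ∑ k ∈ F, timeIn (S k) r d := by
    refine lt_of_le_of_lt (le_trans ?_ hlow) hsum
    linarith
  refine lt_of_lt_of_le ?_ (ofReal_sum_le_totalWork S F r d)
  refine ENNReal.ofReal_lt_ofReal_iff_of_nonneg ?_ |>.2 hfin
  refine mul_nonneg ?_ (sub_nonneg.2 hr.lt.le)
  nlinarith

end JobCollection

theorem theorem1 {J : Type*} (C : JobCollection J) (hC : C.IsNormal) (m : ℕ) (hm : 1 ≤ m) :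
    (C.FeasibleOn m 1 → C.EDFSchedulable m (2 - 1 / (m : ℝ))) ∧
    (∀ α : ℝ, 1 ≤ α →
      C.EDFSchedulable m α ∨
      ¬ C.FeasibleOn ⊤ 1 ∨
      ∃ a b : ℝ, 0 ≤ a ∧ a < b ∧
        ∀ run : J → Set ℝ, C.IsFeasibleSchedule ⊤ 1 run →
          ENNReal.ofReal ((α * m - m + 1) * (b - a)) < totalWork run 1 a b) := by
  have hm1 : (1 : ℝ) ≤ m := by exact_mod_cast hm
  refine ⟨?_, fun α hα => ?_⟩
  · rintro ⟨S, hS⟩ run hrun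
    by_contra hmiss
    have hinv : 1 / (m : ℝ) ≤ 1 := (div_le_one (by linarith)).2 hm1
    have hS' := hS.of_le (n := ⊤) le_top
    obtain ⟨a, b, -, hab, hwork⟩ :=
      hrun.exists_busy_interval hC hm (by linarith) hmiss ⟨S, hS'⟩
    have hα : (2 - 1 / (m : ℝ)) * m - m + 1 = m := by
      field_simp
      ring
    have := hwork S hS'
    rw [hα] at this
    exact absurd (JobCollection.totalWork_le hS.1 hab.le) (not_le.2 this)
  · by_cases hE : C.EDFSchedulable m α
    · exact Or.inl hE
    by_cases hfeas : C.FeasibleOn ⊤ 1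
    · unfold JobCollection.EDFSchedulable at hE
      push Not at hE
      obtain ⟨run, hrun, hmiss⟩ := hE
      exact Or.inr (Or.inr (hrun.exists_busy_interval hC hm (by linarith) hmiss hfeas))
    · exact Or.inr (Or.inl hfeas)
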